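/- Let $n\ge 1$ and let $X_1,\dots,X_n,Y_1,\dots,Y_n,\Theta$ be real random variables on one probability space. Limits "as $x\wedge y\to\infty$" mean $\min\{x,y\}\to\infty$, and $f(x,y)\sim g(x,y)$ means $f(x,y)/g(x,y)\to1$ as $x\wedge y\to\infty$. Definitions. A random variable $X$ is in $\mathcal L$ if $P[X>x-a]/P[X>x]\to1$ as $x\to\infty$ for every $a>0$, and in $\mathcal D$ if $P[X>x]>0$ for all $x$ and $\limsup_{x\to\infty}P[X>bx]/P[X>x]<\infty$ for every $b\in(0,1)$. A pair $(X,Y)$ is in $\mathcal L^{(2)}$ if $X,Y\in\mathcal L$ and $$\lim_{x\wedge y\to\infty}\frac{P[X>x-a_1,\,Y>y-a_2]}{P[X>x,\,Y>y]}=1\quad\text{for all }(a_1,a_2)\in[0,\infty)^2\setminus\{(0,0)\},$$ and in $\mathcal D^{(2)}$ if $X,Y\in\mathcal D$, $P[X>x,Y>y]>0$ for all $x,y$, and $$\limsup_{x\wedge y\to\infty}\frac{P[X>b_1x,\,Y>b_2y]}{P[X>x,\,Y>y]}<\infty\quad\text{for all }(b_1,b_2)\in(0,1)^2.$$ Write $(\mathcal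 D\cap\mathcal L)^{(2)}=\mathcal D^{(2)}\cap\mathcal L^{(2)}$. The variables $X_1,\dots,X_n$ are TAI if $P[|X_i|>x_i\mid X_j>x_j]\to0$ as $x_i\wedge x_j\to\infty$ for all $i\ne j$ (similarly for the $Y$'s). The variables $X_1,\dots,X_n,Y_1,\dots,Y_n$ are GTAI if, for all $i\neq k$ and all $j$, $P[|X_i|>x_i\mid X_k>x_k,\,Y_j>y_j]\to0$ as $\min\{x_i,x_k,y_j\}\to\infty$, and, for all $j\ne k$ and all $i$, $P[|Y_j|>y_j\mid X_i>x_i,\,Y_k>y_k]\to0$ as $\min\{x_i,y_k,y_j\}\to\infty$. Statement. Assume that all $X_k$ and all $Y_l$ are in $\mathcal D\cap\mathcal L$, that $X_1,\dots,X_n,Y_1,\dots,Y_n$ are GTAI, that $(X_k,Y_l)\in(\mathcal D\cap\mathcal L)^{(2)}$ for all $k,l\in\{1,\dots,n\}$, that $X_1,\dots,X_n$ are TAI and that $Y_1,\dots,Y_n$ are TAI. Let $\Theta$ be almost surely non-negative and bounded from above by a constant, with $P[\Theta\le0]<1$, and independent of the random vector $(X_1,\dots,X_n,Y_1,\dots,Y_n)$.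 Put $S_i(\Theta)=\sum_{k=1}^i\Theta X_k$ and $T_j(\Theta)=\sum_{l=1}^j\Theta Y_l$. Then, as $x\wedge y\to\infty$, $$P[S_n(\Theta)>x,\;T_n(\Theta)>y]\sim P\Big[\max_{1\le i\le n}S_i(\Theta)>x,\;\max_{1\le j\le n}T_j(\Theta)>y\Big]$$ $$\sim P\Big[\max_{1\le k\le n}\Theta X_k>x,\;\max_{1\le l\le n}\Theta Y_l>y\Big]\sim\sum_{k=1}^n\sum_{l=1}^nP[\Theta X_k>x,\;\Theta Y_l>y].$$ -/

import Mathlib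

open MeasureTheory ProbabilityTheory Filter Topology
open scoped ENNReal

namespace JointTails

/- Conventions.  Limits "as `x ∧ y → ∞`" (all thresholds tend to infinity, with no relation between
them) are limits along `atTop` on the product `ℝ × ℝ` (or `ℝ × ℝ × ℝ`), whose basic sets are
`{(x, y) | M ≤ x and M ≤ y}`.  Tails are probabilities with values in `ℝ≥0∞`, where `0 / 0 = 0` and
`c / 0 = ∞` for `c ≠ 0`; in particular a quotient of tails can tend to `1` only if its denominator
is eventually positive. -/

variable {Ω : Type*}

/-- The partial sum `Z₁ + ⋯ + Zᵢ`. -/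
def partialSum {n : ℕ} (Z : Fin n → Ω → ℝ) (i : Fin n) (ω : Ω) : ℝ :=
  ∑ k ∈ Finset.Iic i, Z k ω

/-- The maximum `Z₁ ∨ ⋯ ∨ Zₙ` (used for `n ≥ 1` only). -/
noncomputable def maximum {n : ℕ} (Z : Fin n → Ω → ℝ) (ω : Ω) : ℝ :=
  ⨆ k : Fin n, Z k ω

/-- The discounted variables `Θ Z₁, …, Θ Zₙ`. -/
def discounted {n : ℕ} (Θ : Ω → ℝ) (Z : Fin n → Ω → ℝ) (k : Fin n) (ω : Ω) : ℝ :=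
  Θ ω * Z k ω

variable [MeasurableSpace Ω]

/-- The tail `x ↦ P[X > x]` of a random variable. -/
noncomputable def tail (μ : Measure Ω) (X : Ω → ℝ) (x : ℝ) : ℝ≥0∞ :=
  μ {ω | x < X ω}

/-- The joint tail `(x, y) ↦ P[X > x, Y > y]` of a pair of random variables. -/
noncomputable def jointTail (μ : Measure Ω) (X Y : Ω → ℝ) (x y : ℝ) : ℝ≥0∞ :=
  μ {ω | x < X ω ∧ y < Y ω}

/-- The distribution of `X` is long-tailed (class `L`). -/
def IsLongTailed (μ : Measure Ω) (X : Ω → ℝ) : Prop :=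
  ∀ a : ℝ, 0 < a → Tendsto (fun x : ℝ => tail μ X (x - a) / tail μ X x) atTop (𝓝 1)

/-- The distribution of `X` is dominatedly varying (class `D`). -/
def IsDominatedlyVarying (μ : Measure Ω) (X : Ω → ℝ) : Prop :=
  (∀ x : ℝ, 0 < tail μ X x) ∧
  ∀ b : ℝ, 0 < b → b < 1 → limsup (fun x : ℝ => tail μ X (b * x) / tail μ X x) atTop < ∞

/-- The pair `(X, Y)` is bivariate long-tailed (class `L⁽²⁾`). -/
def IsLongTailed₂ (μ : Measure Ω) (X Y : Ω → ℝ) : Prop :=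
  IsLongTailed μ X ∧ IsLongTailed μ Y ∧
  ∀ a₁ a₂ : ℝ, 0 ≤ a₁ → 0 ≤ a₂ → (a₁, a₂) ≠ (0, 0) →
    Tendsto (fun p : ℝ × ℝ => jointTail μ X Y (p.1 - a₁) (p.2 - a₂) / jointTail μ X Y p.1 p.2)
      atTop (𝓝 1)

/-- The pair `(X, Y)` is bivariate dominatedly varying (class `D⁽²⁾`). -/
def IsDominatedlyVarying₂ (μ : Measure Ω) (X Y : Ω → ℝ) : Prop :=
  IsDominatedlyVarying μ X ∧ IsDominatedlyVarying μ Y ∧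
  (∀ x y : ℝ, 0 < jointTail μ X Y x y) ∧
  ∀ b₁ b₂ : ℝ, 0 < b₁ → b₁ < 1 → 0 < b₂ → b₂ < 1 →
    limsup (fun p : ℝ × ℝ => jointTail μ X Y (b₁ * p.1) (b₂ * p.2) / jointTail μ X Y p.1 p.2)
      atTop < ∞

/-- Tail asymptotic independence (TAI) of `X₁, …, Xₙ`. -/
def IsTAI {n : ℕ} (μ : Measure Ω) (X : Fin n → Ω → ℝ) : Prop :=
  ∀ i j : Fin n, i ≠ j →
    Tendsto (fun p : ℝ × ℝ => μ[{ω | p.1 < |X i ω|} | {ω | p.2 < X j ω}]) atTop (𝓝 0)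

/-- Generalized tail asymptotic independence (GTAI) of `X₁, …, Xₙ, Y₁, …, Yₘ`. -/
def IsGTAI {n m : ℕ} (μ : Measure Ω) (X : Fin n → Ω → ℝ) (Y : Fin m → Ω → ℝ) : Prop :=
  (∀ i k : Fin n, i ≠ k → ∀ j : Fin m,
    Tendsto (fun p : ℝ × ℝ × ℝ =>
      μ[{ω | p.1 < |X i ω|} | {ω | p.2.1 < X k ω ∧ p.2.2 < Y j ω}]) atTop (𝓝 0)) ∧
  (∀ j k : Fin m, j ≠ k → ∀ i : Fin n,
    Tendsto (fun p : ℝ × ℝ × ℝ =>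
      μ[{ω | p.1 < |Y j ω|} | {ω | p.2.1 < X i ω ∧ p.2.2 < Y k ω}]) atTop (𝓝 0))

/-- `f(x, y) ∼ g(x, y)` as `x ∧ y → ∞`. -/
def AsympEquiv (f g : ℝ → ℝ → ℝ≥0∞) : Prop :=
  Tendsto (fun p : ℝ × ℝ => f p.1 p.2 / g p.1 p.2) atTop (𝓝 1)

end JointTails

open scoped NNReal

namespace JointTails

/-! One big jump in each coordinate. Sums, maximal partial sums and maxima all lie between `X k -
∑_{i ≠ k} |X i|` (for every `k`) and `∑ i, max (X i) 0`, so it is enough to compare such `IsSumLike`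
statistics with the double sum of joint tails.

Upper bound (`asympLE_jointTail_sum_posPart`): some `X k` and `Y l` exceed a fixed fraction of `x`
and `y`. Either a further variable exceeds a fixed level `a`, which GTAI and dominated variation
make negligible, or the rest adds at most `n * a`, which long tails absorb. Lower bound
(`asympLE_of_forall_sub_sum_le`): the events "only `X k` and `Y l` are large" are disjoint, force
both statistics over their thresholds, and carry almost all of each joint tail.

`AsympLE.mul_indepFun` then inserts `Θ` by conditioning on its value: since `Θ` is bounded, `x / θ`
and `y / θ` are large uniformly in `θ`. -/

/-! ### One-sided asymptotic comparison. -/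

/-- `f ≤ (1 + o(1)) g` as `x ∧ y → ∞`. -/
def AsympLE (f g : ℝ → ℝ → ℝ≥0∞) : Prop :=
  ∀ ε : ℝ≥0, 0 < ε → ∀ᶠ p : ℝ × ℝ in atTop, f p.1 p.2 ≤ (1 + ε) * g p.1 p.2

lemma eventually_atTop_prod_iff {P : ℝ × ℝ → Prop} :
    (∀ᶠ p in atTop, P p) ↔ ∃ M : ℝ, ∀ x y, M ≤ x → M ≤ y → P (x, y) := by
  rw [eventually_atTop]
  constructor
  · rintro ⟨p, hp⟩
    exact ⟨max p.1 p.2, fun x y hx hy =>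
      hp (x, y) ⟨(le_max_left _ _).trans hx, (le_max_right _ _).trans hy⟩⟩
  · rintro ⟨M, hM⟩
    exact ⟨(M, M), fun p hp => hM p.1 p.2 hp.1 hp.2⟩

lemma AsympLE.trans {f g h : ℝ → ℝ → ℝ≥0∞} (hfg : AsympLE f g) (hgh : AsympLE g h) :
    AsympLE f h := by
  intro ε hε
  obtain ⟨δ, hδ, hδε⟩ : ∃ δ : ℝ≥0, 0 < δ ∧ (1 + δ) * (1 + δ) ≤ 1 + ε := by
    -- For `δ ≤ 1`, `(1 + δ)² ≤ 1 + 3δ`.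
    refine ⟨min 1 (ε / 3), by positivity, ?_⟩
    have h1 : min 1 (ε / 3) ≤ 1 := min_le_left _ _
    have h2 : min 1 (ε / 3) ≤ ε / 3 := min_le_right _ _
    set d := min 1 (ε / 3)
    have h3 : (d : ℝ) ≤ 1 := by exact_mod_cast h1
    have h4 : (d : ℝ) ≤ ε / 3 := by exact_mod_cast h2
    have h5 : (0 : ℝ) ≤ d := d.2
    rw [← NNReal.coe_le_coe]
    push_cast
    nlinarith
  filter_upwards [hfg δ hδ, hgh δ hδ] with p h1 h2
  calc f p.1 p.2 ≤ (1 + δ) * ((1 + δ) * h p.1 p.2) := h1.trans (by gcongr)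
    _ = ((1 + δ) * (1 + δ)) * h p.1 p.2 := by rw [mul_assoc]
    _ ≤ (1 + ε) * h p.1 p.2 := by gcongr; exact_mod_cast hδε

lemma AsympLE.asympEquiv {f g : ℝ → ℝ → ℝ≥0∞} (hfg : AsympLE f g) (hgf : AsympLE g f)
    (hg : ∀ᶠ p : ℝ × ℝ in atTop, g p.1 p.2 ≠ 0) (hg' : ∀ x y, g x y ≠ ∞) :
    AsympEquiv f g := by
  refine tendsto_order.2 ⟨fun a ha => ?_, fun a ha => ?_⟩
  · lift a to ℝ≥0 using ha.ne_top
    have ha1 : a < 1 := by exact_mod_cast ha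
    obtain ⟨ε, hε, hεa⟩ : ∃ ε : ℝ≥0, 0 < ε ∧ (1 + ε) * a < 1 := by
      -- `(2 - a) * a = 1 - (1 - a)² < 1`.
      refine ⟨1 - a, tsub_pos_of_lt ha1, ?_⟩
      rw [← NNReal.coe_lt_coe]
      have h1 : (a : ℝ) < 1 := by exact_mod_cast ha1
      push_cast [NNReal.coe_sub ha1.le]
      nlinarith
    filter_upwards [hgf ε hε, hg] with p h1 h2
    rw [ENNReal.lt_div_iff_mul_lt (Or.inl h2) (Or.inl (hg' _ _))]
    by_contra! h3
    have h4 : g p.1 p.2 ≤ ((1 + ε) * a) * g p.1 p.2 := by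
      calc _ ≤ _ := h1
        _ ≤ (1 + ε) * (a * g p.1 p.2) := by gcongr
        _ = _ := by rw [mul_assoc]
    have h5 : ((1 + ε) * a) * g p.1 p.2 < 1 * g p.1 p.2 :=
      ENNReal.mul_lt_mul_left h2 (hg' _ _) (by exact_mod_cast hεa)
    rw [one_mul] at h5
    exact absurd h4 (not_le.2 h5)
  · obtain ⟨b, hb1, hba⟩ := ENNReal.lt_iff_exists_nnreal_btwn.1 ha
    have hb1' : 1 < b := by exact_mod_cast hb1
    filter_upwards [hfg (b - 1) (tsub_pos_of_lt hb1'), hg] with p h1 h2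
    refine lt_of_le_of_lt (ENNReal.div_le_of_le_mul ?_) hba
    have : (1 : ℝ≥0∞) + ((b - 1 : ℝ≥0) : ℝ≥0∞) = b := by
      exact_mod_cast add_tsub_cancel_of_le hb1'.le
    rwa [this] at h1

lemma AsympLE.sum {ι : Type*} [Fintype ι] {f g : ι → ℝ → ℝ → ℝ≥0∞}
    (h : ∀ i, AsympLE (f i) (g i)) :
    AsympLE (fun x y => ∑ i, f i x y) (fun x y => ∑ i, g i x y) := by
  intro ε hε
  filter_upwards [eventually_all.2 fun i => h i ε hε] with p hp
  rw [Finset.mul_sum]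
  exact Finset.sum_le_sum fun i _ => hp i

/-! ### Pointwise bounds and sum-like statistics. -/

variable {Ω : Type*}

/-- The event that `X_k` and `Y_l` exceed `u` and `v`, and one more variable exceeds `a` in absolute
value. -/
def multipleExceedance {n m : ℕ} (X : Fin n → Ω → ℝ) (Y : Fin m → Ω → ℝ) (k : Fin n) (l : Fin m)
    (a u v : ℝ) : Set Ω :=
  (⋃ i : {i // i ≠ k}, {ω | u < X k ω ∧ v < Y l ω} ∩ {ω | a < |X i ω|}) ∪
    ⋃ j : {j // j ≠ l}, {ω | u < X k ω ∧ v < Y l ω} ∩ {ω | a < |Y j ω|}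

section

variable {n : ℕ}

lemma sum_erase_le_of_le {z : Fin n → ℝ} {k : Fin n} {a : ℝ} (ha : 0 ≤ a)
    (h : ∀ i, i ≠ k → z i ≤ a) : ∑ i ∈ Finset.univ.erase k, z i ≤ n * a := by
  refine (Finset.sum_le_card_nsmul _ _ a fun i hi => h i (Finset.ne_of_mem_erase hi)).trans ?_
  rw [nsmul_eq_mul]
  gcongr
  simp

/-- Pigeonhole. The fraction is `1 / (n + 1)` rather than `1 / n` so that it stays below `1` when `n
= 1`, as dominated variation requires. -/
lemma exists_lt_of_lt_sum_posPart {z : Fin n → ℝ} {x : ℝ} (hx : 0 ≤ x)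
    (h : x < ∑ i, max (z i) 0) : ∃ k, ((n : ℝ) + 1)⁻¹ * x < z k := by
  by_contra! hk
  have h1 : ∑ i, max (z i) 0 ≤ n * (((n : ℝ) + 1)⁻¹ * x) := by
    simpa using Finset.sum_le_card_nsmul Finset.univ (fun i => max (z i) 0)
      (((n : ℝ) + 1)⁻¹ * x) fun i _ => max_le (hk i) (by positivity)
  have h2 : n * (((n : ℝ) + 1)⁻¹ * x) ≤ x := by
    rw [← mul_assoc]
    refine mul_le_of_le_one_left hx ?_
    rw [← div_eq_mul_inv, div_le_one (by positivity)]
    linarith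
  linarith

end

/-- Statistics of `Z₁, …, Zₙ` lying between the largest `Z_k - ∑_{i ≠ k} |Z_i|` and the sum of the
positive parts. -/
structure IsSumLike {n : ℕ} (Z : Fin n → Ω → ℝ) (U : Ω → ℝ) : Prop where
  sub_le : ∀ ω k, Z k ω - ∑ i ∈ Finset.univ.erase k, |Z i ω| ≤ U ω
  le_sum : ∀ ω, U ω ≤ ∑ i, max (Z i ω) 0

section

variable {n : ℕ} {Z : Fin n → Ω → ℝ}

lemma isSumLike_sum : IsSumLike Z (fun ω => ∑ k, Z k ω) where
  sub_le ω k := by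
    rw [← Finset.add_sum_erase Finset.univ (fun i => Z i ω) (Finset.mem_univ k), sub_eq_add_neg,
      ← Finset.sum_neg_distrib]
    gcongr
    exact neg_abs_le _
  le_sum ω := Finset.sum_le_sum fun i _ => le_max_left _ _

lemma le_maximum (Z : Fin n → Ω → ℝ) (k : Fin n) (ω : Ω) : Z k ω ≤ maximum Z ω :=
  le_ciSup (f := fun k => Z k ω) (Set.finite_range _).bddAbove k

lemma isSumLike_maximum (hn : 1 ≤ n) : IsSumLike Z (maximum Z) where
  sub_le ω k := (sub_le_self _ (Finset.sum_nonneg fun i _ => abs_nonneg _)).trans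
    (le_maximum Z k ω)
  le_sum ω := by
    have : Nonempty (Fin n) := ⟨⟨0, hn⟩⟩
    exact ciSup_le fun k => (le_max_left _ _).trans (Finset.single_le_sum
      (f := fun i => max (Z i ω) 0) (fun i _ => le_max_right _ _) (Finset.mem_univ k))

lemma partialSum_last (hn : 1 ≤ n) (ω : Ω) :
    partialSum Z ⟨n - 1, by omega⟩ ω = ∑ k, Z k ω := by
  refine Finset.sum_congr (Finset.eq_univ_iff_forall.2 fun k => ?_) fun _ _ => rfl
  rw [Finset.mem_Iic, Fin.le_def]
  have := k.2
  simp only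
  omega

lemma isSumLike_maximum_partialSum (hn : 1 ≤ n) : IsSumLike Z (maximum (partialSum Z)) where
  sub_le ω k := (isSumLike_sum.sub_le ω k).trans (by
    rw [← partialSum_last hn]
    exact le_maximum _ _ ω)
  le_sum ω := by
    have : Nonempty (Fin n) := ⟨⟨0, hn⟩⟩
    refine ciSup_le fun k => ?_
    calc partialSum Z k ω ≤ ∑ i ∈ Finset.Iic k, max (Z i ω) 0 :=
        Finset.sum_le_sum fun i _ => le_max_left _ _
      _ ≤ ∑ i, max (Z i ω) 0 :=
        Finset.sum_le_sum_of_subset_of_nonneg (Finset.subset_univ _) fun i _ _ => le_max_right _ _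

lemma partialSum_discounted (Θ : Ω → ℝ) :
    partialSum (discounted Θ Z) = discounted Θ (partialSum Z) := by
  ext k ω
  simp [partialSum, discounted, Finset.mul_sum]

lemma maximum_discounted {Θ : Ω → ℝ} {ω : Ω} (hω : 0 ≤ Θ ω) :
    maximum (discounted Θ Z) ω = Θ ω * maximum Z ω :=
  (Real.mul_iSup_of_nonneg hω _).symm

lemma measurable_maximum_eval : Measurable fun z : Fin n → ℝ => ⨆ k, z k :=
  Measurable.iSup fun k => measurable_pi_apply k

end

/-! ### Tail estimates from the distributional assumptions. -/

variable [MeasurableSpace Ω] {μ : Measure Ω}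

lemma jointTail_ne_top [IsFiniteMeasure μ] (U V : Ω → ℝ) (x y : ℝ) :
    jointTail μ U V x y ≠ ∞ :=
  measure_ne_top _ _

lemma jointTail_mono {U V U' V' : Ω → ℝ} (hU : ∀ᵐ ω ∂μ, U ω ≤ U' ω) (hV : ∀ᵐ ω ∂μ, V ω ≤ V' ω)
    (x y : ℝ) : jointTail μ U V x y ≤ jointTail μ U' V' x y := by
  refine measure_mono_ae ?_
  filter_upwards [hU, hV] with ω h1 h2 h
  exact ⟨h.1.trans_le h1, h.2.trans_le h2⟩

lemma measure_inter_le_of_cond_le [IsFiniteMeasure μ] {A B : Set Ω} (hB : MeasurableSet B)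
    {δ : ℝ≥0∞} (h : μ[A | B] ≤ δ) : μ (B ∩ A) ≤ δ * μ B := by
  rw [← cond_mul_eq_inter hB]
  gcongr

lemma IsDominatedlyVarying₂.exists_le [IsFiniteMeasure μ] {X Y : Ω → ℝ}
    (h : IsDominatedlyVarying₂ μ X Y) {b : ℝ} (hb : 0 < b) (hb1 : b < 1) :
    ∃ C : ℝ≥0, ∀ᶠ p : ℝ × ℝ in atTop,
      jointTail μ X Y (b * p.1) (b * p.2) ≤ C * jointTail μ X Y p.1 p.2 := by
  obtain ⟨C, hC, -⟩ := ENNReal.lt_iff_exists_nnreal_btwn.1 (h.2.2.2 b b hb hb1 hb hb1)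
  refine ⟨C, ?_⟩
  filter_upwards [eventually_lt_of_limsup_lt hC] with p hp
  exact (ENNReal.div_le_iff (h.2.2.1 _ _).ne' (jointTail_ne_top _ _ _ _)).1 hp.le

lemma IsLongTailed₂.asympLE [IsFiniteMeasure μ] {X Y : Ω → ℝ} (h : IsLongTailed₂ μ X Y)
    (hpos : ∀ x y, 0 < jointTail μ X Y x y) {a : ℝ} (ha : 0 < a) :
    AsympLE (fun x y => jointTail μ X Y (x - a) (y - a)) (jointTail μ X Y) := by
  intro ε hε
  have h1 : (1 : ℝ≥0∞) < 1 + ε := by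
    exact_mod_cast lt_add_of_pos_right (1 : ℝ≥0) hε
  filter_upwards [(h.2.2 a a ha.le ha.le (by simp [ha.ne'])).eventually (gt_mem_nhds h1)] with p hp
  exact (ENNReal.div_le_iff (hpos _ _).ne' (jointTail_ne_top _ _ _ _)).1 hp.le

section

variable {n m : ℕ} {X : Fin n → Ω → ℝ} {Y : Fin m → Ω → ℝ}

lemma measurableSet_exceedance {U V : Ω → ℝ} (hU : Measurable U) (hV : Measurable V) (u v : ℝ) :
    MeasurableSet {ω | u < U ω ∧ v < V ω} :=
  (measurableSet_lt measurable_const hU).inter (measurableSet_lt measurable_const hV)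

lemma measurableSet_multipleExceedance (hX : ∀ k, Measurable (X k)) (hY : ∀ l, Measurable (Y l))
    (k : Fin n) (l : Fin m) (a u v : ℝ) : MeasurableSet (multipleExceedance X Y k l a u v) := by
  have h := measurableSet_exceedance (hX k) (hY l) u v
  unfold multipleExceedance
  exact (MeasurableSet.iUnion fun i : {i // i ≠ k} =>
    h.inter (measurableSet_lt measurable_const (hX i.1).abs)).union
    (MeasurableSet.iUnion fun j : {j // j ≠ l} =>
    h.inter (measurableSet_lt measurable_const (hY j.1).abs))

/-- The order of quantifiers matters: `a` can be fixed first, and the bound then survives as `u` and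
`v` tend to infinity. -/
lemma eventually_forall_of_tendsto_zero {f : ℝ × ℝ × ℝ → ℝ≥0∞} (h : Tendsto f atTop (𝓝 0))
    {δ : ℝ≥0∞} (hδ : 0 < δ) :
    ∀ᶠ a in atTop, ∀ u v, a ≤ u → a ≤ v → f (a, u, v) ≤ δ := by
  obtain ⟨p, hp⟩ := eventually_atTop.1 (h.eventually (gt_mem_nhds hδ))
  filter_upwards [eventually_ge_atTop p.1, eventually_ge_atTop p.2.1,
    eventually_ge_atTop p.2.2] with a h1 h2 h3 u v hu hv
  exact (hp (a, u, v) ⟨h1, h2.trans hu, h3.trans hv⟩).le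

lemma IsGTAI.measure_multipleExceedance_le [IsFiniteMeasure μ] (h : IsGTAI μ X Y)
    (hX : ∀ k, Measurable (X k)) (hY : ∀ l, Measurable (Y l)) (k : Fin n) (l : Fin m)
    {δ : ℝ≥0∞} (hδ : 0 < δ) :
    ∀ᶠ a in atTop, ∀ u v, a ≤ u → a ≤ v →
      μ (multipleExceedance X Y k l a u v) ≤ (n + m) * δ * jointTail μ (X k) (Y l) u v := by
  have h1 : ∀ i : {i // i ≠ k}, _ := fun i =>
    eventually_forall_of_tendsto_zero (h.1 i.1 k i.2 l) hδ
  have h2 : ∀ j : {j // j ≠ l}, _ := fun j =>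
    eventually_forall_of_tendsto_zero (h.2 j.1 l j.2 k) hδ
  filter_upwards [eventually_all.2 h1, eventually_all.2 h2] with a ha1 ha2 u v hu hv
  have hB := measurableSet_exceedance (hX k) (hY l) u v
  refine (measure_union_le _ _).trans ?_
  rw [add_mul, add_mul]
  gcongr ?_ + ?_
  · refine (measure_iUnion_fintype_le _ _).trans ((Finset.sum_le_card_nsmul _ _
      (δ * jointTail μ (X k) (Y l) u v) fun i _ =>
        measure_inter_le_of_cond_le hB (ha1 i u v hu hv)).trans ?_)
    rw [nsmul_eq_mul, mul_assoc]
    gcongr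
    simp
  · refine (measure_iUnion_fintype_le _ _).trans ((Finset.sum_le_card_nsmul _ _
      (δ * jointTail μ (X k) (Y l) u v) fun j _ =>
        measure_inter_le_of_cond_le hB (ha2 j u v hu hv)).trans ?_)
    rw [nsmul_eq_mul, mul_assoc]
    gcongr
    simp

end

/-! ### Upper and lower bounds without the factor `Θ`. -/

section

variable {n : ℕ} {X Y : Fin n → Ω → ℝ}

/-- If no other variable exceeds `a` in absolute value, then `X k > x - n * a` and `Y l > y - n *
a`, and long tails remove the shift. Otherwise GTAI applies at the levels `b * x`, `b * y`, and
dominated variation returns to `x`, `y` at the cost of a constant `C`. -/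
lemma asympLE_jointTail_sum_posPart_pair [IsFiniteMeasure μ]
    (hX : ∀ k, Measurable (X k)) (hY : ∀ l, Measurable (Y l)) (hG : IsGTAI μ X Y) (k l : Fin n)
    (hD : IsDominatedlyVarying₂ μ (X k) (Y l)) (hL : IsLongTailed₂ μ (X k) (Y l)) :
    AsympLE (fun x y => μ {ω | (((n : ℝ) + 1)⁻¹ * x < X k ω ∧ ((n : ℝ) + 1)⁻¹ * y < Y l ω) ∧
      x < ∑ i, max (X i ω) 0 ∧ y < ∑ j, max (Y j ω) 0}) (jointTail μ (X k) (Y l)) := by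
  intro ε hε
  have hn : 0 < n := k.pos
  have hb : (0 : ℝ) < ((n : ℝ) + 1)⁻¹ := by positivity
  have hb1 : ((n : ℝ) + 1)⁻¹ < 1 := inv_lt_one_of_one_lt₀ (by simpa using hn)
  obtain ⟨C, hC⟩ := hD.exists_le hb hb1
  set b := ((n : ℝ) + 1)⁻¹
  have hδ : 0 < ε / 2 / (((n : ℝ≥0) + n) * (C + 1)) := by positivity
  -- `δ` depends on `C`, and `a` below on `δ`; `C + 1` avoids dividing by zero.
  obtain ⟨δ, hδ, hδC⟩ : ∃ δ : ℝ≥0, 0 < δ ∧ ((n : ℝ≥0) + n) * δ * C ≤ ε / 2 := by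
    refine ⟨ε / 2 / (((n : ℝ≥0) + n) * (C + 1)), hδ, ?_⟩
    rw [mul_div_assoc', mul_comm, mul_div_assoc', div_le_iff₀ (by positivity)]
    calc C * (((n : ℝ≥0) + n) * (ε / 2)) = ε / 2 * ((n + n) * C) := by ring
      _ ≤ _ := by gcongr; simp
  obtain ⟨a, ha, ha0⟩ := ((hG.measure_multipleExceedance_le hX hY k l
    (ENNReal.coe_pos.2 hδ)).and (eventually_gt_atTop 0)).exists
  have hna : 0 < n * a := by positivity
  have hge : ∀ᶠ p : ℝ × ℝ in atTop, a / b ≤ p.1 ∧ a / b ≤ p.2 :=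
    eventually_atTop_prod_iff.2 ⟨a / b, fun x y hx hy => ⟨hx, hy⟩⟩
  filter_upwards [hC, hL.asympLE hD.2.2.1 hna (ε / 2) (by positivity), hge] with p h1 h2 h3
  obtain ⟨x, y⟩ := p
  have hu : a ≤ b * x := by rw [mul_comm]; exact (div_le_iff₀ hb).1 h3.1
  have hv : a ≤ b * y := by rw [mul_comm]; exact (div_le_iff₀ hb).1 h3.2
  have hsub : {ω | (b * x < X k ω ∧ b * y < Y l ω) ∧
      x < ∑ i, max (X i ω) 0 ∧ y < ∑ j, max (Y j ω) 0} ⊆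
      {ω | x - n * a < X k ω ∧ y - n * a < Y l ω} ∪
        multipleExceedance X Y k l a (b * x) (b * y) := by
    rintro ω ⟨hkl, hx, hy⟩
    by_cases hi : ∃ i : {i // i ≠ k}, a < |X i ω|
    · obtain ⟨i, hi⟩ := hi
      exact Or.inr (Or.inl (Set.mem_iUnion.2 ⟨i, hkl, hi⟩))
    by_cases hj : ∃ j : {j // j ≠ l}, a < |Y j ω|
    · obtain ⟨j, hj⟩ := hj
      exact Or.inr (Or.inr (Set.mem_iUnion.2 ⟨j, hkl, hj⟩))
    push Not at hi hj
    have hk0 : max (X k ω) 0 = X k ω := max_eq_left ((ha0.le.trans hu).trans hkl.1.le)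
    have hl0 : max (Y l ω) 0 = Y l ω := max_eq_left ((ha0.le.trans hv).trans hkl.2.le)
    have h5 := sum_erase_le_of_le (z := fun i => max (X i ω) 0) (k := k) ha0.le fun i h =>
      max_le ((le_abs_self _).trans (hi ⟨i, h⟩)) ha0.le
    have h6 := sum_erase_le_of_le (z := fun j => max (Y j ω) 0) (k := l) ha0.le fun j h =>
      max_le ((le_abs_self _).trans (hj ⟨j, h⟩)) ha0.le
    have h7 := Finset.add_sum_erase Finset.univ (fun i => max (X i ω) 0) (Finset.mem_univ k)
    have h8 := Finset.add_sum_erase Finset.univ (fun j => max (Y j ω) 0) (Finset.mem_univ l)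
    simp only [hk0] at h7
    simp only [hl0] at h8
    exact Or.inl ⟨by linarith, by linarith⟩
  refine (measure_mono hsub).trans ((measure_union_le _ _).trans ?_)
  have h4 : μ (multipleExceedance X Y k l a (b * x) (b * y)) ≤
      (ε / 2 : ℝ≥0) * jointTail μ (X k) (Y l) x y := by
    calc _ ≤ _ := ha _ _ hu hv
      _ ≤ (n + n) * δ * (C * jointTail μ (X k) (Y l) x y) := by gcongr
      _ = ((((n : ℝ≥0) + n) * δ * C : ℝ≥0) : ℝ≥0∞) * jointTail μ (X k) (Y l) x y := by
        push_cast; ring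
      _ ≤ _ := by gcongr
  calc _ ≤ (1 + (ε / 2 : ℝ≥0)) * jointTail μ (X k) (Y l) x y +
      (ε / 2 : ℝ≥0) * jointTail μ (X k) (Y l) x y := add_le_add h2 h4
    _ = (1 + ((ε / 2 + ε / 2 : ℝ≥0) : ℝ≥0∞)) * jointTail μ (X k) (Y l) x y := by
      push_cast; ring
    _ = _ := by rw [add_halves]

lemma asympLE_jointTail_sum_posPart [IsFiniteMeasure μ]
    (hX : ∀ k, Measurable (X k)) (hY : ∀ l, Measurable (Y l)) (hG : IsGTAI μ X Y)
    (hD : ∀ k l, IsDominatedlyVarying₂ μ (X k) (Y l)) (hL : ∀ k l, IsLongTailed₂ μ (X k) (Y l)) :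
    AsympLE (jointTail μ (fun ω => ∑ i, max (X i ω) 0) (fun ω => ∑ j, max (Y j ω) 0))
      (fun x y => ∑ k, ∑ l, jointTail μ (X k) (Y l) x y) := by
  intro ε hε
  filter_upwards [AsympLE.sum (fun k => AsympLE.sum fun l =>
    asympLE_jointTail_sum_posPart_pair hX hY hG k l (hD k l) (hL k l)) ε hε,
    eventually_atTop_prod_iff (P := fun p => 0 ≤ p.1 ∧ 0 ≤ p.2).2
      ⟨0, fun x y hx hy => ⟨hx, hy⟩⟩] with p h h0
  refine le_trans ?_ h
  refine le_trans (measure_mono (t := ⋃ k, ⋃ l, {ω | (((n : ℝ) + 1)⁻¹ * p.1 < X k ω ∧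
    ((n : ℝ) + 1)⁻¹ * p.2 < Y l ω) ∧
      p.1 < ∑ i, max (X i ω) 0 ∧ p.2 < ∑ j, max (Y j ω) 0}) ?_) ?_
  · intro ω hω
    obtain ⟨k, hk⟩ := exists_lt_of_lt_sum_posPart h0.1 hω.1
    obtain ⟨l, hl⟩ := exists_lt_of_lt_sum_posPart h0.2 hω.2
    exact Set.mem_iUnion₂.2 ⟨k, l, ⟨hk, hl⟩, hω⟩
  · exact (measure_iUnion_fintype_le _ _).trans
      (Finset.sum_le_sum fun k _ => measure_iUnion_fintype_le _ _)

lemma asympLE_of_forall_sub_sum_le [IsFiniteMeasure μ]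
    (hX : ∀ k, Measurable (X k)) (hY : ∀ l, Measurable (Y l)) (hG : IsGTAI μ X Y)
    (hD : ∀ k l, IsDominatedlyVarying₂ μ (X k) (Y l)) (hL : ∀ k l, IsLongTailed₂ μ (X k) (Y l))
    {U V : Ω → ℝ} (hU : ∀ ω k, X k ω - ∑ i ∈ Finset.univ.erase k, |X i ω| ≤ U ω)
    (hV : ∀ ω l, Y l ω - ∑ j ∈ Finset.univ.erase l, |Y j ω| ≤ V ω) :
    AsympLE (fun x y => ∑ k, ∑ l, jointTail μ (X k) (Y l) x y) (jointTail μ U V) := by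
  intro ε hε
  -- Exact solution of the equation needed to cancel in `hbound`.
  obtain ⟨δ, hδ, hδε⟩ : ∃ δ : ℝ≥0, 0 < δ ∧ (1 + δ) + (1 + ε) * ((n + n) * δ) = 1 + ε := by
    have hne : 1 + (1 + ε) * ((n : ℝ≥0) + n) ≠ 0 := by positivity
    refine ⟨ε / (1 + (1 + ε) * (n + n)), by positivity, ?_⟩
    field_simp
    ring
  obtain ⟨a, ha, ha0⟩ := ((eventually_all.2 fun k => eventually_all.2 fun l =>
    hG.measure_multipleExceedance_le hX hY k l
      (ENNReal.coe_pos.2 hδ)).and (eventually_gt_atTop 0)).exists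
  have hLT : ∀ᶠ p : ℝ × ℝ in atTop, ∀ k l, jointTail μ (X k) (Y l) p.1 p.2 ≤
      (1 + δ) * jointTail μ (X k) (Y l) (p.1 + n * a) (p.2 + n * a) := by
    refine eventually_all.2 fun k => eventually_all.2 fun l => ?_
    have hn : 0 < n := k.pos
    have hna : 0 < n * a := by positivity
    obtain ⟨M, hM⟩ := eventually_atTop_prod_iff.1
      ((hL k l).asympLE (hD k l).2.2.1 hna δ hδ)
    refine eventually_atTop_prod_iff.2 ⟨M, fun x y hx hy => ?_⟩
    simpa using hM (x + n * a) (y + n * a) (by linarith) (by linarith)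
  filter_upwards [hLT, eventually_atTop_prod_iff (P := fun p => a ≤ p.1 ∧ a ≤ p.2).2
      ⟨a, fun x y hx hy => ⟨hx, hy⟩⟩] with p hp hpa
  obtain ⟨x, y⟩ := p
  have hna : 0 ≤ n * a := by positivity
  have hax : a ≤ x + n * a := hpa.1.trans (le_add_of_nonneg_right hna)
  have hay : a ≤ y + n * a := hpa.2.trans (le_add_of_nonneg_right hna)
  set E : Fin n × Fin n → Set Ω := fun q =>
    {ω | x + n * a < X q.1 ω ∧ y + n * a < Y q.2 ω} \
      multipleExceedance X Y q.1 q.2 a (x + n * a) (y + n * a) with hE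
  have hEmeas : ∀ q, MeasurableSet (E q) := fun q =>
    (measurableSet_exceedance (hX _) (hY _) _ _).diff
      (measurableSet_multipleExceedance hX hY _ _ _ _ _)
  have hEX : ∀ q, ∀ ω ∈ E q, ∀ i, i ≠ q.1 → |X i ω| ≤ a := by
    intro q ω hω i hi
    by_contra! h
    exact hω.2 (Or.inl (Set.mem_iUnion.2 ⟨⟨i, hi⟩, hω.1, h⟩))
  have hEY : ∀ q, ∀ ω ∈ E q, ∀ j, j ≠ q.2 → |Y j ω| ≤ a := by
    intro q ω hω j hj
    by_contra! h
    exact hω.2 (Or.inr (Set.mem_iUnion.2 ⟨⟨j, hj⟩, hω.1, h⟩))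
  -- If `q` and `r` differ in a coordinate, the variable that is large on `E q` is at most `a` on `E
  -- r`, while its threshold is at least `a`.
  have hdisj : Pairwise (Function.onFun Disjoint E) := by
    intro q r hqr
    refine Set.disjoint_left.2 fun ω hq hr => hqr (Prod.ext ?_ ?_)
    · by_contra h
      have h1 := (le_abs_self _).trans (hEX r ω hr q.1 h)
      have h2 := hq.1.1
      linarith
    · by_contra h
      have h1 := (le_abs_self _).trans (hEY r ω hr q.2 h)
      have h2 := hq.1.2
      linarith
  have hsub : (⋃ q, E q) ⊆ {ω | x < U ω ∧ y < V ω} := by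
    refine Set.iUnion_subset fun q ω hω => ⟨?_, ?_⟩
    · have h1 := hU ω q.1
      have h2 := sum_erase_le_of_le (z := fun i => |X i ω|) ha0.le (hEX q ω hω)
      have h3 := hω.1.1
      linarith
    · have h1 := hV ω q.2
      have h2 := sum_erase_le_of_le (z := fun j => |Y j ω|) ha0.le (hEY q ω hω)
      have h3 := hω.1.2
      linarith
  have hbound : ∀ q : Fin n × Fin n,
      jointTail μ (X q.1) (Y q.2) x y ≤ (1 + ε) * μ (E q) := by
    intro q
    set t := jointTail μ (X q.1) (Y q.2) (x + n * a) (y + n * a) with ht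
    have ht' : t ≠ ∞ := jointTail_ne_top _ _ _ _
    have h1 : t ≤ μ (E q) + ((n + n) * δ : ℝ≥0) * t := by
      refine (measure_le_inter_add_sdiff μ _
        (multipleExceedance X Y q.1 q.2 a (x + n * a) (y + n * a))).trans ?_
      rw [add_comm]
      gcongr
      refine (measure_mono Set.inter_subset_right).trans
        ((ha q.1 q.2 _ _ hax hay).trans_eq ?_)
      push_cast
      rfl
    have h2 : jointTail μ (X q.1) (Y q.2) x y ≤ (1 + δ) * t := hp q.1 q.2
    have h3 : ((1 + ε) * ((n + n) * δ) : ℝ≥0) * t ≠ ∞ := ENNReal.mul_ne_top ENNReal.coe_ne_top ht'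
    -- Subtraction in `ℝ≥0∞` is avoided by adding a finite multiple of `t` to both sides.
    refine (ENNReal.add_le_add_iff_right h3).1 ?_
    calc _ ≤ (1 + δ) * t + ((1 + ε) * ((n + n) * δ) : ℝ≥0) * t := by gcongr
      _ = ((1 + δ) + (1 + ε) * ((n + n) * δ) : ℝ≥0) * t := by push_cast; ring
      _ = (1 + ε) * t := by rw [hδε]; push_cast; rfl
      _ ≤ (1 + ε) * (μ (E q) + ((n + n) * δ : ℝ≥0) * t) := by gcongr
      _ = _ := by push_cast; ring
  calc ∑ k, ∑ l, jointTail μ (X k) (Y l) x y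
      = ∑ q : Fin n × Fin n, jointTail μ (X q.1) (Y q.2) x y := by
        rw [← Finset.univ_product_univ, Finset.sum_product]
    _ ≤ ∑ q, (1 + ε) * μ (E q) := Finset.sum_le_sum fun q _ => hbound q
    _ = (1 + ε) * μ (⋃ q, E q) := by
      rw [measure_iUnion hdisj hEmeas, tsum_fintype, Finset.mul_sum]
    _ ≤ (1 + ε) * jointTail μ U V x y := by gcongr; exact measure_mono hsub

end

/-! ### The independent factor `Θ`. -/

section

variable {Θ : Ω → ℝ}

lemma jointTail_mul_eq_lintegral [IsProbabilityMeasure μ] {U V : Ω → ℝ} (hΘ : Measurable Θ)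
    (hU : Measurable U) (hV : Measurable V) (h : IndepFun Θ (fun ω => (U ω, V ω)) μ) (x y : ℝ) :
    jointTail μ (fun ω => Θ ω * U ω) (fun ω => Θ ω * V ω) x y =
      ∫⁻ θ, jointTail μ (fun ω => θ * U ω) (fun ω => θ * V ω) x y ∂(μ.map Θ) := by
  have hW : Measurable fun ω => (U ω, V ω) := hU.prodMk hV
  set S : Set (ℝ × ℝ × ℝ) := {q | x < q.1 * q.2.1 ∧ y < q.1 * q.2.2} with hS
  have hSm : MeasurableSet S :=
    measurableSet_exceedance (by fun_prop) (by fun_prop) x y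
  have h1 := (indepFun_iff_map_prod_eq_prod_map_map hΘ.aemeasurable hW.aemeasurable).1 h
  have h2 : jointTail μ (fun ω => Θ ω * U ω) (fun ω => Θ ω * V ω) x y =
      μ.map (fun ω => (Θ ω, U ω, V ω)) S := by
    rw [Measure.map_apply (hΘ.prodMk hW) hSm]; rfl
  have : IsProbabilityMeasure (μ.map fun ω => (U ω, V ω)) :=
    Measure.isProbabilityMeasure_map hW.aemeasurable
  rw [h2, h1, Measure.prod_apply hSm]
  refine lintegral_congr fun θ => ?_
  rw [Measure.map_apply hW (measurable_prodMk_left hSm)]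
  rfl

lemma jointTail_const_mul {U V : Ω → ℝ} {θ : ℝ} (hθ : 0 < θ) (x y : ℝ) :
    jointTail μ (fun ω => θ * U ω) (fun ω => θ * V ω) x y = jointTail μ U V (x / θ) (y / θ) := by
  simp only [jointTail, div_lt_iff₀' hθ]

lemma jointTail_zero_mul {U V : Ω → ℝ} {x : ℝ} (hx : 0 ≤ x) (y : ℝ) :
    jointTail μ (fun ω => 0 * U ω) (fun ω => 0 * V ω) x y = 0 := by
  simp [jointTail, hx.not_gt]

/-- Asymptotic inequalities between sums of joint tails are preserved by an independent, bounded,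
nonnegative random discount factor. -/
lemma AsympLE.mul_indepFun [IsProbabilityMeasure μ] {ι κ : Type*} [Fintype ι] [Fintype κ]
    {U V : ι → Ω → ℝ} {U' V' : κ → Ω → ℝ} (hΘ : Measurable Θ)
    (hΘ0 : ∀ᵐ ω ∂μ, 0 ≤ Θ ω) (hΘc : ∃ c : ℝ, ∀ᵐ ω ∂μ, Θ ω ≤ c)
    (hU : ∀ i, Measurable (U i)) (hV : ∀ i, Measurable (V i))
    (hU' : ∀ i, Measurable (U' i)) (hV' : ∀ i, Measurable (V' i))
    (hi : ∀ i, IndepFun Θ (fun ω => (U i ω, V i ω)) μ)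
    (hi' : ∀ i, IndepFun Θ (fun ω => (U' i ω, V' i ω)) μ)
    (h : AsympLE (fun x y => ∑ i, jointTail μ (U i) (V i) x y)
      (fun x y => ∑ i, jointTail μ (U' i) (V' i) x y)) :
    AsympLE (fun x y => ∑ i, jointTail μ (fun ω => Θ ω * U i ω) (fun ω => Θ ω * V i ω) x y)
      (fun x y => ∑ i, jointTail μ (fun ω => Θ ω * U' i ω) (fun ω => Θ ω * V' i ω) x y) := by
  intro ε hε
  obtain ⟨M, hM⟩ := eventually_atTop_prod_iff.1 (h ε hε)
  obtain ⟨c, hc⟩ := hΘc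
  have hmeas : ∀ (x y : ℝ) {A B : Ω → ℝ}, Measurable A → Measurable B → Measurable fun θ : ℝ =>
      jointTail μ (fun ω => θ * A ω) (fun ω => θ * B ω) x y := fun x y A B hA hB =>
    measurable_measure_prodMk_left (ν := μ)
      (s := {q : ℝ × Ω | x < q.1 * A q.2 ∧ y < q.1 * B q.2})
      (measurableSet_exceedance (by fun_prop) (by fun_prop) x y)
  -- With this threshold `x / θ ≥ M` for every `0 < θ ≤ c`. It is also nonnegative, so both sides
  -- vanish at `θ = 0`.
  refine eventually_atTop_prod_iff.2 ⟨|c| * |M|, fun x y hx hy => ?_⟩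
  have hx0 : 0 ≤ x := le_trans (by positivity) hx
  simp only [jointTail_mul_eq_lintegral hΘ (hU _) (hV _) (hi _),
    jointTail_mul_eq_lintegral hΘ (hU' _) (hV' _) (hi' _)]
  rw [← lintegral_finsetSum _ fun i _ => hmeas x y (hU i) (hV i),
    ← lintegral_finsetSum _ fun i _ => hmeas x y (hU' i) (hV' i),
    ← lintegral_const_mul _ (Finset.measurable_fun_sum _ fun i _ => hmeas x y (hU' i) (hV' i))]
  refine lintegral_mono_ae ?_
  have hae : ∀ᵐ θ ∂(μ.map Θ), 0 ≤ θ ∧ θ ≤ c :=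
    (ae_map_iff hΘ.aemeasurable measurableSet_Icc).2 (hΘ0.and hc)
  filter_upwards [hae] with θ hθ
  rcases hθ.1.eq_or_lt with rfl | h0
  · simp only [jointTail_zero_mul hx0]
    simp
  · simp only [jointTail_const_mul h0]
    have key : ∀ z, |c| * |M| ≤ z → M ≤ z / θ := fun z hz => by
      rw [le_div_iff₀ h0]
      calc M * θ ≤ |M| * θ := by gcongr; exact le_abs_self M
        _ ≤ |M| * |c| := by gcongr; exact hθ.2.trans (le_abs_self c)
        _ ≤ z := by rwa [mul_comm]
    exact hM _ _ (key x hx) (key y hy)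

/-- `Θ ≥ r` has positive probability for some `r > 0`; by independence it occurs together with `U >
|x| / r` and `V > |y| / r`. -/
lemma jointTail_mul_pos [IsProbabilityMeasure μ] {U V : Ω → ℝ} (hΘ : Measurable Θ)
    (h : IndepFun Θ (fun ω => (U ω, V ω)) μ)
    (hΘ1 : μ {ω | Θ ω ≤ 0} < 1) (hpos : ∀ x y, 0 < jointTail μ U V x y) (x y : ℝ) :
    0 < jointTail μ (fun ω => Θ ω * U ω) (fun ω => Θ ω * V ω) x y := by
  obtain ⟨r, hr0, hr⟩ : ∃ r : ℝ, 0 < r ∧ 0 < μ {ω | r ≤ Θ ω} := by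
    by_contra! hr
    have h1 : μ (⋃ k : ℕ, {ω | 1 / ((k : ℝ) + 1) ≤ Θ ω}) = 0 :=
      measure_iUnion_null fun k => nonpos_iff_eq_zero.1 (hr _ (by positivity))
    have h2 : μ {ω | Θ ω ≤ 0}ᶜ = 0 := by
      refine measure_mono_null (fun ω hω => ?_) h1
      obtain ⟨k, hk⟩ := exists_nat_one_div_lt (show 0 < Θ ω from not_le.1 hω)
      exact Set.mem_iUnion.2 ⟨k, le_of_lt hk⟩
    exact hΘ1.ne ((prob_compl_eq_zero_iff (measurableSet_le hΘ measurable_const)).1 h2)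
  have hprod := h.measure_inter_preimage_eq_mul (Set.Ici r)
    {q : ℝ × ℝ | |x| / r < q.1 ∧ |y| / r < q.2} measurableSet_Ici
    (measurableSet_exceedance measurable_fst measurable_snd _ _)
  have hlt : ∀ (z t θ : ℝ), r ≤ θ → |z| / r < t → z < θ * t := by
    intro z t θ hθ ht
    have ht0 : 0 < t := lt_of_le_of_lt (by positivity) ht
    rw [div_lt_iff₀' hr0] at ht
    exact (le_abs_self z).trans_lt (ht.trans_le (by gcongr))
  refine lt_of_lt_of_le (b := μ (Θ ⁻¹' Set.Ici r ∩ (fun ω => (U ω, V ω)) ⁻¹'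
    {q : ℝ × ℝ | |x| / r < q.1 ∧ |y| / r < q.2})) ?_ (measure_mono ?_)
  · rw [hprod]
    exact ENNReal.mul_pos hr.ne' (hpos _ _).ne'
  · rintro ω ⟨h1, h2⟩
    exact ⟨hlt _ _ _ h1 h2.1, hlt _ _ _ h1 h2.2⟩

end

/-- Joint tails of any two sum-like statistics, discounted by `Θ`, are asymptotically equivalent. -/
lemma jointTail_discounted_asympLE [IsProbabilityMeasure μ] {n : ℕ} {X Y : Fin n → Ω → ℝ}
    {Θ : Ω → ℝ} (hX : ∀ k, Measurable (X k)) (hY : ∀ l, Measurable (Y l)) (hΘ : Measurable Θ)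
    (hG : IsGTAI μ X Y) (hD : ∀ k l, IsDominatedlyVarying₂ μ (X k) (Y l))
    (hL : ∀ k l, IsLongTailed₂ μ (X k) (Y l))
    (hΘ0 : ∀ᵐ ω ∂μ, 0 ≤ Θ ω) (hΘc : ∃ c : ℝ, ∀ᵐ ω ∂μ, Θ ω ≤ c)
    (hi : IndepFun Θ (fun ω => ((fun k => X k ω), (fun l => Y l ω))) μ)
    {u v : (Fin n → ℝ) → ℝ} (hu : Measurable u) (hv : Measurable v)
    (hU : IsSumLike X fun ω => u fun k => X k ω) (hV : IsSumLike Y fun ω => v fun l => Y l ω) :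
    AsympLE (jointTail μ (fun ω => Θ ω * u fun k => X k ω) (fun ω => Θ ω * v fun l => Y l ω))
      (fun x y => ∑ k, ∑ l, jointTail μ (discounted Θ X k) (discounted Θ Y l) x y) ∧
    AsympLE (fun x y => ∑ k, ∑ l, jointTail μ (discounted Θ X k) (discounted Θ Y l) x y)
      (jointTail μ (fun ω => Θ ω * u fun k => X k ω) (fun ω => Θ ω * v fun l => Y l ω)) := by
  have hXm : Measurable fun ω k => X k ω := measurable_pi_lambda _ hX
  have hYm : Measurable fun ω l => Y l ω := measurable_pi_lambda _ hY
  have hiUV : IndepFun Θ (fun ω => (u fun k => X k ω, v fun l => Y l ω)) μ :=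
    hi.comp (ψ := fun q : (Fin n → ℝ) × (Fin n → ℝ) => (u q.1, v q.2)) measurable_id
      (by fun_prop)
  have hiXY : ∀ q : Fin n × Fin n, IndepFun Θ (fun ω => (X q.1 ω, Y q.2 ω)) μ := fun q =>
    hi.comp (ψ := fun z : (Fin n → ℝ) × (Fin n → ℝ) => (z.1 q.1, z.2 q.2)) measurable_id
      (by fun_prop)
  have hle : AsympLE (jointTail μ (fun ω => u fun k => X k ω) (fun ω => v fun l => Y l ω))
      (fun x y => ∑ k, ∑ l, jointTail μ (X k) (Y l) x y) := by
    intro ε hε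
    filter_upwards [asympLE_jointTail_sum_posPart hX hY hG hD hL ε hε] with p hp
    exact (jointTail_mono (.of_forall hU.le_sum) (.of_forall hV.le_sum) _ _).trans hp
  have hge := asympLE_of_forall_sub_sum_le hX hY hG hD hL hU.sub_le hV.sub_le
  simp only [← Fintype.sum_prod_type'] at hle hge ⊢
  constructor
  · have t := AsympLE.mul_indepFun (ι := Unit) (κ := Fin n × Fin n)
      (U := fun _ ω => u fun k => X k ω) (V := fun _ ω => v fun l => Y l ω)
      (U' := fun q => X q.1) (V' := fun q => Y q.2) hΘ hΘ0 hΘc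
      (fun _ => hu.comp hXm) (fun _ => hv.comp hYm) (fun q => hX q.1) (fun q => hY q.2)
      (fun _ => hiUV) hiXY (by simpa using hle)
    simp only [Finset.univ_unique, Finset.sum_singleton] at t
    exact t
  · have t := AsympLE.mul_indepFun (ι := Fin n × Fin n) (κ := Unit)
      (U := fun q => X q.1) (V := fun q => Y q.2)
      (U' := fun _ ω => u fun k => X k ω) (V' := fun _ ω => v fun l => Y l ω) hΘ hΘ0 hΘc
      (fun q => hX q.1) (fun q => hY q.2) (fun _ => hu.comp hXm) (fun _ => hv.comp hYm)
      hiXY (fun _ => hiUV) (by simpa using hge)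
    simp only [Finset.univ_unique, Finset.sum_singleton] at t
    exact t

lemma jointTail_congr {U V U' V' : Ω → ℝ} (hU : ∀ᵐ ω ∂μ, U ω = U' ω)
    (hV : ∀ᵐ ω ∂μ, V ω = V' ω) : jointTail μ U V = jointTail μ U' V' := by
  ext x y
  exact le_antisymm
    (jointTail_mono (hU.mono fun _ h => h.le) (hV.mono fun _ h => h.le) x y)
    (jointTail_mono (hU.mono fun _ h => h.ge) (hV.mono fun _ h => h.ge) x y)

lemma measurable_maximum_partialSum {n : ℕ} :
    Measurable fun z : Fin n → ℝ => ⨆ i, ∑ k ∈ Finset.Iic i, z k :=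
  Measurable.iSup fun _ => Finset.measurable_fun_sum _ fun k _ => measurable_pi_apply k

end JointTails

theorem mainTheorem9 {Ω : Type*} [MeasurableSpace Ω] (μ : Measure Ω) [IsProbabilityMeasure μ]
    (n : ℕ) (hn : 1 ≤ n) (X Y : Fin n → Ω → ℝ) (Θ : Ω → ℝ)
    (hX : ∀ k, Measurable (X k)) (hY : ∀ l, Measurable (Y l)) (hΘ : Measurable Θ)
    (hXDL : ∀ k, JointTails.IsDominatedlyVarying μ (X k) ∧ JointTails.IsLongTailed μ (X k))
    (hYDL : ∀ l, JointTails.IsDominatedlyVarying μ (Y l) ∧ JointTails.IsLongTailed μ (Y l))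
    (hGTAI : JointTails.IsGTAI μ X Y)
    (hXY : ∀ k l, JointTails.IsDominatedlyVarying₂ μ (X k) (Y l) ∧
      JointTails.IsLongTailed₂ μ (X k) (Y l))
    (hXTAI : JointTails.IsTAI μ X) (hYTAI : JointTails.IsTAI μ Y)
    (hΘ_nonneg : ∀ᵐ ω ∂μ, 0 ≤ Θ ω)
    (hΘ_bdd : ∃ c : ℝ, ∀ᵐ ω ∂μ, Θ ω ≤ c)
    (hΘ_nondeg : μ {ω | Θ ω ≤ 0} < 1)
    (hΘ_indep : IndepFun Θ (fun ω => ((fun k => X k ω), (fun l => Y l ω))) μ) :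
    JointTails.AsympEquiv
      (JointTails.jointTail μ
        (fun ω => ∑ k, JointTails.discounted Θ X k ω)
        (fun ω => ∑ l, JointTails.discounted Θ Y l ω))
      (JointTails.jointTail μ
        (JointTails.maximum (JointTails.partialSum (JointTails.discounted Θ X)))
        (JointTails.maximum (JointTails.partialSum (JointTails.discounted Θ Y)))) ∧
    JointTails.AsympEquiv
      (JointTails.jointTail μ
        (JointTails.maximum (JointTails.partialSum (JointTails.discounted Θ X)))
        (JointTails.maximum (JointTails.partialSum (JointTails.discounted Θ Y))))
      (JointTails.jointTail μ
        (JointTails.maximum (JointTails.discounted Θ X))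
        (JointTails.maximum (JointTails.discounted Θ Y))) ∧
    JointTails.AsympEquiv
      (JointTails.jointTail μ
        (JointTails.maximum (JointTails.discounted Θ X))
        (JointTails.maximum (JointTails.discounted Θ Y)))
      (fun x y => ∑ k, ∑ l, JointTails.jointTail μ
        (JointTails.discounted Θ X k) (JointTails.discounted Θ Y l) x y) := by
  have key := fun {u v : (Fin n → ℝ) → ℝ} => JointTails.jointTail_discounted_asympLE
    (u := u) (v := v) hX hY hΘ hGTAI (fun k l => (hXY k l).1) (fun k l => (hXY k l).2)
    hΘ_nonneg hΘ_bdd hΘ_indep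
  have h1 := key (u := fun z => ∑ k, z k) (v := fun z => ∑ k, z k) (by fun_prop) (by fun_prop)
    JointTails.isSumLike_sum JointTails.isSumLike_sum
  have h2 := key JointTails.measurable_maximum_partialSum JointTails.measurable_maximum_partialSum
    (JointTails.isSumLike_maximum_partialSum hn) (JointTails.isSumLike_maximum_partialSum hn)
  have h3 := key JointTails.measurable_maximum_eval JointTails.measurable_maximum_eval
    (JointTails.isSumLike_maximum hn) (JointTails.isSumLike_maximum hn)
  have e1 : JointTails.jointTail μ (fun ω => ∑ k, JointTails.discounted Θ X k ω)
      (fun ω => ∑ l, JointTails.discounted Θ Y l ω) =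
      JointTails.jointTail μ (fun ω => Θ ω * ∑ k, X k ω) (fun ω => Θ ω * ∑ l, Y l ω) := by
    simp only [JointTails.discounted, Finset.mul_sum]
  have hmax : ∀ Z : Fin n → Ω → ℝ, ∀ᵐ ω ∂μ,
      JointTails.maximum (JointTails.discounted Θ Z) ω = Θ ω * JointTails.maximum Z ω :=
    fun Z => hΘ_nonneg.mono fun ω hω => JointTails.maximum_discounted hω
  rw [e1, JointTails.partialSum_discounted, JointTails.partialSum_discounted,
    JointTails.jointTail_congr (hmax _) (hmax _), JointTails.jointTail_congr (hmax X) (hmax Y)]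
  have hsum_pos : ∀ x y, 0 < ∑ k, ∑ l, JointTails.jointTail μ
      (JointTails.discounted Θ X k) (JointTails.discounted Θ Y l) x y := by
    intro x y
    have hi : IndepFun Θ (fun ω => (X ⟨0, hn⟩ ω, Y ⟨0, hn⟩ ω)) μ :=
      hΘ_indep.comp (ψ := fun z : (Fin n → ℝ) × (Fin n → ℝ) => (z.1 ⟨0, hn⟩, z.2 ⟨0, hn⟩))
        measurable_id (by fun_prop)
    refine (JointTails.jointTail_mul_pos hΘ hi hΘ_nondeg
      (hXY _ _).1.2.2.1 x y).trans_le ?_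
    exact (Finset.single_le_sum (f := fun l => JointTails.jointTail μ
      (JointTails.discounted Θ X ⟨0, hn⟩) (JointTails.discounted Θ Y l) x y)
      (fun _ _ => zero_le) (Finset.mem_univ _)).trans
      (Finset.single_le_sum (f := fun k => ∑ l, JointTails.jointTail μ
        (JointTails.discounted Θ X k) (JointTails.discounted Θ Y l) x y)
        (fun _ _ => zero_le) (Finset.mem_univ _))
  -- Denominators inherit positivity from the double sum, which is eventually at most `2 * f`.
  have hpos : ∀ {f : ℝ → ℝ → ℝ≥0∞}, JointTails.AsympLE (fun x y => ∑ k, ∑ l,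
      JointTails.jointTail μ (JointTails.discounted Θ X k) (JointTails.discounted Θ Y l) x y) f →
      ∀ᶠ p : ℝ × ℝ in atTop, f p.1 p.2 ≠ 0 := fun hf => by
    filter_upwards [hf 1 one_pos] with p hp h0
    rw [h0, mul_zero] at hp
    exact (hsum_pos p.1 p.2).not_ge hp
  -- Every comparison passes through the double sum.
  refine ⟨(h1.1.trans h2.2).asympEquiv (h2.1.trans h1.2) (hpos h2.2) fun _ _ => measure_ne_top _ _,
    (h2.1.trans h3.2).asympEquiv (h3.1.trans h2.2) (hpos h3.2) fun _ _ => measure_ne_top _ _,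
    h3.1.asympEquiv h3.2 (.of_forall fun p => (hsum_pos p.1 p.2).ne') fun _ _ => ?_⟩
  exact ENNReal.sum_ne_top.2 fun k _ => ENNReal.sum_ne_top.2 fun l _ => measure_ne_top _ _
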